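/- Let $H$ be a separable infinite-dimensional complex Hilbert space and let $s(X)=(s_n(X))_{n\ge 1}$ denote the sequence of $s$-numbers of $X\in B(H)$ (the distances, in operator norm, from $X$ to the operators of rank at most $n-1$). Let $c_o^*$ be the set of real sequences decreasing (not necessarily strictly) to $0$. For a sequence $\xi$ let $\xi_a:=\left\langle \frac1n\sum_{i=1}^n \xi_i\right\rangle_{n\ge 1}$. By Calkin's correspondence, a proper two-sided ideal $I$ of $B(H)$ is determined by its characteristic set $\Sigma(I)=\{s(X)\mid X\in I\}\subset c_o^*$. The pre-arithmetic mean ideal ${}_aI$ and the arithmetic mean ideal $I_a$ are the ideals with characteristic sets $$\Sigma({}_aI)=\{\xi\in c_o^*\mid \xi_a\in\Sigma(I)\},\qquad \Sigma(I_a)=\{\xi\in c_o^*\mid \xi=O(\eta_a)\text{ for some }\eta\in\Sigma(I)\},$$ where $\xi=O(\eta_a)$ means that there is a constant $C$ with $\xi_n\le C(\eta_a)_n$ for all $n$. The am-closure of $I$ is $I^-:={}_a(I_a)$. The ideal $I$ is called am-closed if $I=I^-$, am-stable if $I=I_a$, and countably generated if it is generated, as a two-sided ideal, by a countable set of operators.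 Theorem. A countably generated proper two-sided ideal $I$ of $B(H)$ is am-closed if and only if it is am-stable. -/

import Mathlib

open Filter Topology

noncomputable section

namespace OperatorIdeal

/-- The cone of real sequences decreasing to zero (they are automatically nonnegative).
Sequences are indexed from `0`, so the `n`-th term of the usual indexing is `ξ (n - 1)`. -/
def cZeroStar : Set (ℕ → ℝ) :=
  {ξ | Antitone ξ ∧ Tendsto ξ atTop (𝓝 0)}

/-- The arithmetic mean sequence: its `n`-th term (counting from `0`) is the average of the
first `n + 1` terms of `ξ`. -/
def arithMean (ξ : ℕ → ℝ) : ℕ → ℝ :=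
  fun n => (∑ i ∈ Finset.range (n + 1), ξ i) / ((n : ℝ) + 1)

variable {H : Type*} [NormedAddCommGroup H] [InnerProductSpace ℂ H]

/-- The sequence of s-numbers (singular numbers) of a bounded operator on a Hilbert space:
`sNumbers X n` is the distance in operator norm from `X` to the operators of rank at most `n`.
For compact `X` these are the eigenvalues of `|X|` in decreasing order, repeated according to
multiplicity (with zeros appended if `X` has finite rank). -/
def sNumbers (X : H →L[ℂ] H) : ℕ → ℝ :=
  fun n => sInf {r : ℝ | ∃ F : H →L[ℂ] H,
    LinearMap.rank (F : H →ₗ[ℂ] H) ≤ (n : Cardinal) ∧ r = ‖X - F‖}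

/-- The characteristic set of a (proper) two-sided ideal of `B(H)`: all sequences of s-numbers
of its members. -/
def charSet (I : TwoSidedIdeal (H →L[ℂ] H)) : Set (ℕ → ℝ) :=
  {ξ | ∃ X ∈ I, sNumbers X = ξ}

variable (H) in
/-- The ideal corresponding to a characteristic set `S`: the two-sided ideal of `B(H)` generated
by the operators whose s-number sequence lies in `S`. For `S` contained in `cZeroStar` this is
the same as the ideal generated by the diagonal operators `diag ξ`, `ξ ∈ S`, relative to an
orthonormal basis, since an operator with s-number sequence `ξ` decreasing to zero
has the form `U (diag ξ) V` with bounded `U`, `V`, and conversely. -/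
def idealOf (S : Set (ℕ → ℝ)) : TwoSidedIdeal (H →L[ℂ] H) :=
  TwoSidedIdeal.span {X | sNumbers X ∈ S}

/-- The pre-arithmetic mean ideal `ₐI`: its characteristic set consists of the `ξ` decreasing to
zero whose arithmetic mean sequence is in the characteristic set of `I`. -/
def preMeanIdeal (I : TwoSidedIdeal (H →L[ℂ] H)) : TwoSidedIdeal (H →L[ℂ] H) :=
  idealOf H {ξ | ξ ∈ cZeroStar ∧ arithMean ξ ∈ charSet I}

/-- The arithmetic mean ideal `Iₐ`: its characteristic set consists of the `ξ` decreasing to zero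
such that `ξ = O(ηₐ)` for some `η` in the characteristic set of `I`. The bound is required for
every index, so only `ξ = 0` is `O(0)`. -/
def meanIdeal (I : TwoSidedIdeal (H →L[ℂ] H)) : TwoSidedIdeal (H →L[ℂ] H) :=
  idealOf H {ξ | ξ ∈ cZeroStar ∧ ∃ η ∈ charSet I, ∃ C : ℝ, ∀ n, ξ n ≤ C * arithMean η n}

/-- The am-closure `I⁻ = ₐ(Iₐ)`. -/
def amClosure (I : TwoSidedIdeal (H →L[ℂ] H)) : TwoSidedIdeal (H →L[ℂ] H) :=
  preMeanIdeal (meanIdeal I)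

/-- An ideal is am-closed if it equals its am-closure. -/
def IsAMClosed (I : TwoSidedIdeal (H →L[ℂ] H)) : Prop :=
  I = amClosure I

/-- An ideal is am-stable if it equals its arithmetic mean ideal. -/
def IsAMStable (I : TwoSidedIdeal (H →L[ℂ] H)) : Prop :=
  I = meanIdeal I

/-- An ideal is countably generated if it is generated, as a two-sided ideal, by a countable set
of operators. -/
def IsCountablyGenerated (I : TwoSidedIdeal (H →L[ℂ] H)) : Prop :=
  ∃ G : Set (H →L[ℂ] H), G.Countable ∧ I = TwoSidedIdeal.span G

end OperatorIdeal

end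

/-! By Calkin's correspondence both conditions become equations for S = `charSet I`: stability is S
= `meanSet S`, closedness is S = `preMeanSet (meanSet S)`. The first gives the second because ξ ≤
ξ_a (`eq_preMeanSet_of_eq_meanSet`).

For the converse, countable generation supplies a sequence θ_k in S such that every member of S lies
below some θ_k (`IsCountablyGenerated.exists_dominating`). If η ∈ S but η_a ∉ S, then for each k the
bound η_a ≤ 2^k θ_k fails at some index m_k. Let ξ be the sum over k of the step functions equal to
2^(-k) η_a(m_k) on [0, m_k]. Each step has mean at most 2^(-k) η_a, so ξ_a ≤ 2η_a (`exists_spread`)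
and closedness puts ξ in S. But ξ(m_k) > θ_k(m_k) for every k, so no θ_k dominates ξ
(`eq_meanSet_of_eq_preMeanSet`).

Calkin's correspondence rests on Schmidt decompositions: an operator with null s-numbers factors
through the diagonal operator of its s-numbers and can be compressed to it (`exists_schmidt`,
`exists_eq_mul_isDiag_mul`, `exists_isDiag_mul_mul`). An operator whose s-numbers do not tend to
zero compresses to an invertible diagonal, so it lies in no proper ideal. -/

namespace OperatorIdeal

/-! ### Null sequences and their arithmetic means -/

/-- Sets of sequences closed under the operations that characterise the characteristic sets of
proper two-sided ideals. -/
structure IsCharSet (S : Set (ℕ → ℝ)) : Prop where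
  subset : S ⊆ cZeroStar
  zero_mem : 0 ∈ S
  add_mem : ∀ {ξ η}, ξ ∈ S → η ∈ S → ξ + η ∈ S
  dilate_mem : ∀ {ξ}, ξ ∈ S → (fun n => ξ (n / 2)) ∈ S
  of_le : ∀ {ξ ζ : ℕ → ℝ} (C : ℝ), ξ ∈ S → ζ ∈ cZeroStar → (∀ n, ζ n ≤ C * ξ n) → ζ ∈ S

theorem cZeroStar.nonneg {ξ : ℕ → ℝ} (h : ξ ∈ cZeroStar) (n : ℕ) : 0 ≤ ξ n :=
  h.1.le_of_tendsto h.2 n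

theorem cZeroStar.zero : (0 : ℕ → ℝ) ∈ cZeroStar :=
  ⟨antitone_const, tendsto_const_nhds⟩

theorem cZeroStar.add {ξ η : ℕ → ℝ} (hξ : ξ ∈ cZeroStar) (hη : η ∈ cZeroStar) :
    ξ + η ∈ cZeroStar :=
  ⟨hξ.1.add hη.1, by simpa [Pi.add_def] using hξ.2.add hη.2⟩

theorem cZeroStar.const_mul {ξ : ℕ → ℝ} {c : ℝ} (hc : 0 ≤ c) (hξ : ξ ∈ cZeroStar) :
    (fun n => c * ξ n) ∈ cZeroStar :=
  ⟨fun _ _ h => mul_le_mul_of_nonneg_left (hξ.1 h) hc, by simpa using hξ.2.const_mul c⟩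

theorem cZeroStar.dilate {ξ : ℕ → ℝ} (hξ : ξ ∈ cZeroStar) :
    (fun n => ξ (n / 2)) ∈ cZeroStar :=
  ⟨fun _ _ h => hξ.1 (Nat.div_le_div_right h),
    hξ.2.comp (Nat.tendsto_div_const_atTop two_ne_zero)⟩

theorem IsCharSet.const_mul_mem {S : Set (ℕ → ℝ)} (hS : IsCharSet S) {ξ : ℕ → ℝ} (hξ : ξ ∈ S)
    {c : ℝ} (hc : 0 ≤ c) : (fun n => c * ξ n) ∈ S :=
  hS.of_le c hξ (cZeroStar.const_mul hc (hS.subset hξ)) fun _ => le_rfl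

theorem arithMean_add (ξ η : ℕ → ℝ) : arithMean (ξ + η) = arithMean ξ + arithMean η := by
  funext n
  simp [arithMean, Finset.sum_add_distrib, add_div]

theorem arithMean_zero : arithMean 0 = 0 := by
  funext n
  simp [arithMean]

theorem arithMean_const_mul (c : ℝ) (ξ : ℕ → ℝ) (n : ℕ) :
    arithMean (fun i => c * ξ i) n = c * arithMean ξ n := by
  simp [arithMean, ← Finset.mul_sum, mul_div_assoc]

theorem arithMean_mono {ξ η : ℕ → ℝ} (h : ∀ n, ξ n ≤ η n) (n : ℕ) :
    arithMean ξ n ≤ arithMean η n := by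
  unfold arithMean
  gcongr with i
  exact h i

theorem arithMean_nonneg {ξ : ℕ → ℝ} (h : ∀ n, 0 ≤ ξ n) (n : ℕ) : 0 ≤ arithMean ξ n :=
  div_nonneg (Finset.sum_nonneg fun i _ => h i) (by positivity)

theorem le_arithMean {ξ : ℕ → ℝ} (h : Antitone ξ) (n : ℕ) : ξ n ≤ arithMean ξ n := by
  rw [arithMean, le_div_iff₀ (by positivity)]
  calc ξ n * ((n : ℝ) + 1) = ∑ _i ∈ Finset.range (n + 1), ξ n := by simp; ring
    _ ≤ _ := Finset.sum_le_sum fun i hi => h (by simp at hi; omega)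

theorem arithMean_antitone {ξ : ℕ → ℝ} (h : Antitone ξ) : Antitone (arithMean ξ) := by
  refine antitone_nat_of_succ_le fun n => ?_
  have h1 := (h (Nat.le_succ n)).trans (le_arithMean h n)
  unfold arithMean at *
  rw [le_div_iff₀ (by positivity)] at h1
  rw [Finset.sum_range_succ, div_le_div_iff₀ (by positivity) (by positivity)]
  push_cast
  nlinarith

theorem arithMean_mem_cZeroStar {ξ : ℕ → ℝ} (h : ξ ∈ cZeroStar) : arithMean ξ ∈ cZeroStar := by
  refine ⟨arithMean_antitone h.1, ?_⟩
  have h1 := (tendsto_add_atTop_iff_nat 1).2 h.2.cesaro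
  refine h1.congr fun n => ?_
  simp [arithMean, div_eq_inv_mul]

theorem sum_range_dilate (ξ : ℕ → ℝ) (n : ℕ) :
    ∑ i ∈ Finset.range (2 * n), ξ (i / 2) = 2 * ∑ i ∈ Finset.range n, ξ i := by
  induction n with
  | zero => simp
  | succ n ih =>
    rw [show 2 * (n + 1) = 2 * n + 1 + 1 by ring, Finset.sum_range_succ, Finset.sum_range_succ, ih,
      Finset.sum_range_succ, show (2 * n + 1) / 2 = n by omega, show 2 * n / 2 = n by omega]
    ring

/-- Each term is repeated twice, so even the first 2(n + 1) terms sum to only twice the original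
sum. This makes `preMeanSet` closed under dilation. -/
theorem arithMean_dilate_le {ξ : ℕ → ℝ} (h : ∀ n, 0 ≤ ξ n) (n : ℕ) :
    arithMean (fun i => ξ (i / 2)) n ≤ 2 * arithMean ξ n := by
  unfold arithMean
  rw [← mul_div_assoc, ← sum_range_dilate]
  gcongr
  · exact fun i _ _ => h _
  · omega

/-- The sum only loses nonnegative terms, while the denominator shrinks by a factor of at most 2.
This makes `meanSet` closed under dilation. -/
theorem arithMean_div_two_le {ξ : ℕ → ℝ} (h : ∀ n, 0 ≤ ξ n) (n : ℕ) :
    arithMean ξ (n / 2) ≤ 2 * arithMean ξ n := by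
  have h1 : ∑ i ∈ Finset.range (n / 2 + 1), ξ i ≤ ∑ i ∈ Finset.range (n + 1), ξ i :=
    Finset.sum_le_sum_of_subset_of_nonneg
      (Finset.range_subset_range.2 (by omega)) fun i _ _ => h i
  have h0 : 0 ≤ ∑ i ∈ Finset.range (n / 2 + 1), ξ i := Finset.sum_nonneg fun i _ => h i
  have h2 : (n : ℝ) + 1 ≤ 2 * (((n / 2 : ℕ) : ℝ) + 1) := by
    norm_cast
    omega
  unfold arithMean
  rw [← mul_div_assoc, div_le_div_iff₀ (by positivity) (by positivity)]
  nlinarith [mul_le_mul h1 h2 (by positivity) (h0.trans h1)]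

/-! ### Mean and pre-mean operations on characteristic sets -/

/-- The characteristic set of the arithmetic mean ideal. -/
def meanSet (S : Set (ℕ → ℝ)) : Set (ℕ → ℝ) :=
  {ξ | ξ ∈ cZeroStar ∧ ∃ η ∈ S, ∃ C : ℝ, ∀ n, ξ n ≤ C * arithMean η n}

/-- The characteristic set of the pre-arithmetic mean ideal. -/
def preMeanSet (S : Set (ℕ → ℝ)) : Set (ℕ → ℝ) :=
  {ξ | ξ ∈ cZeroStar ∧ arithMean ξ ∈ S}

theorem arithMean_mem_meanSet {S : Set (ℕ → ℝ)} (hS : IsCharSet S) {ξ : ℕ → ℝ} (h : ξ ∈ S) :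
    arithMean ξ ∈ meanSet S :=
  ⟨arithMean_mem_cZeroStar (hS.subset h), ξ, h, 1, fun _ => by simp⟩

theorem IsCharSet.meanSet {S : Set (ℕ → ℝ)} (hS : IsCharSet S) : IsCharSet (meanSet S) where
  subset := fun _ h => h.1
  zero_mem := ⟨cZeroStar.zero, 0, hS.zero_mem, 0, by simp⟩
  add_mem := by
    rintro ξ ξ' ⟨h, η, hη, C, hC⟩ ⟨h', η', hη', C', hC'⟩
    refine ⟨cZeroStar.add h h', η + η', hS.add_mem hη hη', |C| + |C'|, fun n => ?_⟩
    have a := arithMean_nonneg (cZeroStar.nonneg (hS.subset hη)) n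
    have a' := arithMean_nonneg (cZeroStar.nonneg (hS.subset hη')) n
    rw [arithMean_add]
    simp only [Pi.add_apply]
    nlinarith [hC n, hC' n, le_abs_self C, le_abs_self C', abs_nonneg C, abs_nonneg C',
      mul_nonneg (abs_nonneg C) a', mul_nonneg (abs_nonneg C') a,
      mul_le_mul_of_nonneg_right (le_abs_self C) a, mul_le_mul_of_nonneg_right (le_abs_self C') a']
  dilate_mem := by
    rintro ξ ⟨h, η, hη, C, hC⟩
    refine ⟨(cZeroStar.dilate h), η, hη, |C| * 2, fun n => ?_⟩
    have a := arithMean_div_two_le (cZeroStar.nonneg (hS.subset hη)) n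
    have a' := arithMean_nonneg (cZeroStar.nonneg (hS.subset hη)) (n / 2)
    nlinarith [hC (n / 2), mul_le_mul_of_nonneg_right (le_abs_self C) a',
      mul_le_mul_of_nonneg_left a (abs_nonneg C)]
  of_le := by
    rintro ξ ζ D ⟨h, η, hη, C, hC⟩ hζ hD
    refine ⟨hζ, η, hη, |D| * C, fun n => ?_⟩
    nlinarith [hD n, mul_le_mul_of_nonneg_right (le_abs_self D) ((cZeroStar.nonneg h) n),
      mul_le_mul_of_nonneg_left (hC n) (abs_nonneg D)]

theorem IsCharSet.preMeanSet {S : Set (ℕ → ℝ)} (hS : IsCharSet S) :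
    IsCharSet (preMeanSet S) where
  subset := fun _ h => h.1
  zero_mem := ⟨cZeroStar.zero, by rw [arithMean_zero]; exact hS.zero_mem⟩
  add_mem := by
    rintro ξ ξ' ⟨h, ha⟩ ⟨h', ha'⟩
    exact ⟨cZeroStar.add h h', by rw [arithMean_add]; exact hS.add_mem ha ha'⟩
  dilate_mem := by
    rintro ξ ⟨h, ha⟩
    exact ⟨(cZeroStar.dilate h), hS.of_le 2 ha (arithMean_mem_cZeroStar (cZeroStar.dilate h))
      (arithMean_dilate_le (cZeroStar.nonneg h))⟩
  of_le := by
    rintro ξ ζ C ⟨h, ha⟩ hζ hC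
    exact ⟨hζ, hS.of_le C ha (arithMean_mem_cZeroStar hζ) fun n =>
      (arithMean_mono hC n).trans_eq (arithMean_const_mul C ξ n)⟩

theorem subset_meanSet {S : Set (ℕ → ℝ)} (hS : IsCharSet S) : S ⊆ meanSet S := fun ξ h =>
  ⟨hS.subset h, ξ, h, 1, fun n => by simpa using le_arithMean (hS.subset h).1 n⟩

theorem eq_preMeanSet_of_eq_meanSet {S : Set (ℕ → ℝ)} (hS : IsCharSet S) (h : S = meanSet S) :
    S = preMeanSet (meanSet S) := by
  rw [← h]
  refine Set.Subset.antisymm (fun ξ hξ => ⟨hS.subset hξ, ?_⟩) fun ξ hξ => ?_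
  · rw [h]
    exact arithMean_mem_meanSet hS hξ
  · exact hS.of_le 1 hξ.2 hξ.1 fun n => by simpa using le_arithMean hξ.1.1 n

/-! ### The spreading construction and the theorem for sequences -/

/-- Given points `m k`, a decreasing null sequence which at `m k` is at least `2⁻ᵏ` times the
mean of `η` up to `m k`, but is nevertheless submajorized by a multiple of `η`. -/
theorem exists_spread {η : ℕ → ℝ} (hη : η ∈ cZeroStar) (m : ℕ → ℕ) :
    ∃ ξ ∈ cZeroStar, (∀ k, (1 / 2 : ℝ) ^ k * arithMean η (m k) ≤ ξ (m k)) ∧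
      ∀ n, arithMean ξ n ≤ 2 * arithMean η n := by
  have hpos := arithMean_nonneg (cZeroStar.nonneg hη)
  have hanti := arithMean_antitone hη.1
  -- The k-th step function; ξ is the sum of these over k, and the weights 2^(-k) make it converge
  -- uniformly.
  set t : ℕ → ℕ → ℝ := fun n k => if n ≤ m k then (1 / 2 : ℝ) ^ k * arithMean η (m k) else 0
    with ht
  have ht0 : ∀ n k, 0 ≤ t n k := fun n k => by
    have := hpos (m k)
    simp only [ht]; split_ifs <;> positivity
  have htb : ∀ n k, t n k ≤ (1 / 2 : ℝ) ^ k * arithMean η 0 := fun n k => by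
    have h0 := hpos 0
    simp only [ht]; split_ifs
    · gcongr
      exact hanti (Nat.zero_le _)
    · positivity
  have hsum0 : Summable fun k : ℕ => (1 / 2 : ℝ) ^ k * arithMean η 0 :=
    summable_geometric_two.mul_right _
  have hsum : ∀ n, Summable (t n) := fun n => Summable.of_nonneg_of_le (ht0 n) (htb n) hsum0
  refine ⟨fun n => ∑' k, t n k, ⟨fun a b hab => ?_, ?_⟩, fun k => ?_, fun n => ?_⟩
  · refine (hsum b).tsum_le_tsum (fun k => ?_) (hsum a)
    have := hpos (m k)
    simp only [ht]
    split_ifs with h1 h2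
    · rfl
    · omega
    · positivity
    · rfl
  -- Each step vanishes beyond `m k`, so dominated convergence gives a null sequence.
  · have := tendsto_tsum_of_dominated_convergence (𝓕 := atTop) (f := t) (g := fun _ => (0 : ℝ))
      hsum0 (fun k => ?_) (Eventually.of_forall fun n k => by
        rw [Real.norm_of_nonneg (ht0 n k)]; exact htb n k)
    · simpa using this
    · refine tendsto_const_nhds.congr' ?_
      filter_upwards [eventually_gt_atTop (m k)] with n hn
      simp [ht, not_le.2 hn]
  · refine le_trans ?_ ((hsum (m k)).le_tsum k fun j _ => ht0 _ j)
    simp [ht]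
  -- Up to `m k` the step is constant, and the mean of `η` at `n` is at least that at `m k`. Beyond
  -- `m k`, the total of the step is 2^(-k) times the sum of `η` up to `m k`, hence at most 2^(-k)
  -- times the sum up to `n`.
  · have key : ∀ k, arithMean (fun i => t i k) n ≤ (1 / 2 : ℝ) ^ k * arithMean η n := by
      intro k
      rcases le_total n (m k) with hn | hn
      · have : ∀ i ∈ Finset.range (n + 1), t i k = (1 / 2 : ℝ) ^ k * arithMean η (m k) :=
          fun i hi => if_pos (by simp at hi; omega)
        rw [arithMean, Finset.sum_congr rfl this]
        simp only [Finset.sum_const, Finset.card_range, nsmul_eq_mul, Nat.cast_add, Nat.cast_one]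
        rw [mul_div_cancel_left₀ _ (by positivity)]
        gcongr
        exact hanti hn
      · have : ∑ i ∈ Finset.range (n + 1), t i k
            = ∑ i ∈ Finset.range (m k + 1), (1 / 2 : ℝ) ^ k * arithMean η (m k) := by
          rw [← Finset.sum_filter]
          congr 1
          ext i
          simp
          omega
        rw [arithMean, this]
        simp only [Finset.sum_const, Finset.card_range, nsmul_eq_mul, Nat.cast_add, Nat.cast_one]
        rw [arithMean, arithMean, mul_left_comm, mul_div_cancel₀ _ (by positivity),
          mul_div_assoc]
        gcongr
        exact fun i _ _ => (cZeroStar.nonneg hη) i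
    have hE : arithMean (fun i => ∑' k, t i k) n = ∑' k, arithMean (fun i => t i k) n := by
      unfold arithMean
      rw [tsum_div_const, Summable.tsum_finsetSum fun i _ => hsum i]
    have hS2 : Summable fun k : ℕ => (1 / 2 : ℝ) ^ k * arithMean η n :=
      summable_geometric_two.mul_right _
    rw [hE]
    calc _ ≤ ∑' k : ℕ, (1 / 2 : ℝ) ^ k * arithMean η n :=
          (Summable.of_nonneg_of_le (fun k => arithMean_nonneg (fun i => ht0 i k) n) key
            hS2).tsum_le_tsum key hS2
      _ = _ := by rw [tsum_mul_right, tsum_geometric_two]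

theorem eq_meanSet_of_eq_preMeanSet {S : Set (ℕ → ℝ)} (hS : IsCharSet S) {θ : ℕ → ℕ → ℝ}
    (hθ : ∀ k, θ k ∈ S) (hdom : ∀ ξ ∈ S, ∃ k, ∀ n, ξ n ≤ θ k n)
    (h : S = preMeanSet (meanSet S)) : S = meanSet S := by
  refine (subset_meanSet hS).antisymm ?_
  rintro ζ ⟨hζ, η, hη, C, hC⟩
  have hηc := hS.subset hη
  -- Every `ζ` in `meanSet S` is bounded by a multiple of such a mean.
  suffices H : arithMean η ∈ S from hS.of_le C H hζ hC
  by_contra H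
  have : ∀ k, ∃ n, 2 ^ k * θ k n < arithMean η n := by
    intro k
    by_contra! hk
    exact H (hS.of_le (2 ^ k) (hθ k) (arithMean_mem_cZeroStar hηc) hk)
  choose m hm using this
  obtain ⟨ξ, hξ, hlow, hup⟩ := exists_spread hηc m
  have hξS : ξ ∈ S := by
    rw [h]
    exact ⟨hξ, arithMean_mem_cZeroStar hξ, η, hη, 2, hup⟩
  obtain ⟨k, hk⟩ := hdom ξ hξS
  have h1 := (hlow k).trans (hk (m k))
  -- The weight 2^(-k) in `ξ` cancels the factor 2^k in the choice of `m k`.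
  have h2 := mul_lt_mul_of_pos_left (hm k) (show (0 : ℝ) < (1 / 2) ^ k by positivity)
  rw [← mul_assoc, ← mul_pow] at h2
  norm_num at h1 h2
  linarith

/-! ### A cofinal sequence built from countably many members -/

/-- A sequence dominating, up to finitely many steps, all combinations of the sequences `σ k`. -/
def dominating (σ : ℕ → ℕ → ℝ) : ℕ → ℕ → ℝ
  | 0 => σ 0
  | k + 1 => fun n => 2 * dominating σ k (n / 2) + σ (k + 1) n

theorem dominating_mem {S : Set (ℕ → ℝ)} (hS : IsCharSet S) {σ : ℕ → ℕ → ℝ}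
    (hσ : ∀ k, σ k ∈ S) (k : ℕ) : dominating σ k ∈ S := by
  induction k with
  | zero => exact hσ 0
  | succ k ih => exact hS.add_mem (hS.const_mul_mem (hS.dilate_mem ih) zero_le_two) (hσ (k + 1))

/-- One step of the recursion absorbs a dilation or a sum of two sequences, and j steps absorb a
factor 2^j. -/
theorem isCharSet_dominated {S : Set (ℕ → ℝ)} (hS : IsCharSet S) {σ : ℕ → ℕ → ℝ}
    (hσ : ∀ k, σ k ∈ S) :
    IsCharSet {ξ | ξ ∈ cZeroStar ∧ ∃ k, ∀ n, ξ n ≤ dominating σ k n} := by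
  have hmem := dominating_mem hS hσ
  have hnn := fun k => cZeroStar.nonneg (hS.subset (hmem k))
  have hσn := fun k => cZeroStar.nonneg (hS.subset (hσ k))
  have hdil : ∀ k n, 2 * dominating σ k (n / 2) ≤ dominating σ (k + 1) n := fun k n => by
    simp [dominating, hσn (k + 1) n]
  have htwo : ∀ k n, 2 * dominating σ k n ≤ dominating σ (k + 1) n := fun k n =>
    (mul_le_mul_of_nonneg_left ((hS.subset (hmem k)).1 (Nat.div_le_self n 2)) zero_le_two).trans
      (hdil k n)
  have hpow : ∀ j k n, 2 ^ j * dominating σ k n ≤ dominating σ (k + j) n := by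
    intro j k n
    induction j with
    | zero => simp
    | succ j ih =>
      have := htwo (k + j) n
      rw [pow_succ]
      rw [← add_assoc]
      linarith
  have hmono : ∀ n, Monotone fun k => dominating σ k n := fun n =>
    monotone_nat_of_le_succ fun k => by linarith [htwo k n, hnn k n]
  refine ⟨fun _ h => h.1, ⟨cZeroStar.zero, 0, fun n => hnn 0 n⟩, ?_, ?_, ?_⟩
  · rintro ξ η ⟨h, k, hk⟩ ⟨h', k', hk'⟩
    refine ⟨cZeroStar.add h h', max k k' + 1, fun n => ?_⟩
    have h1 := (hk n).trans (hmono n (le_max_left k k'))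
    have h2 := (hk' n).trans (hmono n (le_max_right k k'))
    have := htwo (max k k') n
    simp only [Pi.add_apply]
    linarith
  · rintro ξ ⟨h, k, hk⟩
    refine ⟨(cZeroStar.dilate h), k + 1, fun n => ?_⟩
    have := hdil k n
    linarith [hk (n / 2), hnn k (n / 2)]
  · rintro ξ ζ C ⟨h, k, hk⟩ hζ hC
    obtain ⟨j, hj⟩ := pow_unbounded_of_one_lt C (one_lt_two (α := ℝ))
    refine ⟨hζ, k + j, fun n => (hC n).trans (le_trans ?_ (hpow j k n))⟩
    exact (mul_le_mul_of_nonneg_right hj.le ((cZeroStar.nonneg h) n)).trans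
      (mul_le_mul_of_nonneg_left (hk n) (by positivity))

theorem le_dominating {S : Set (ℕ → ℝ)} (hS : IsCharSet S) {σ : ℕ → ℕ → ℝ}
    (hσ : ∀ k, σ k ∈ S) (k n : ℕ) : σ k n ≤ dominating σ k n := by
  cases k with
  | zero => rfl
  | succ k => simp [dominating, cZeroStar.nonneg (hS.subset (dominating_mem hS hσ k)) (n / 2)]

/-! ### Inequalities for s-numbers -/

section SNumbers

variable {H : Type*} [NormedAddCommGroup H] [InnerProductSpace ℂ H]

theorem sNumbers_le {X F : H →L[ℂ] H} {n : ℕ}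
    (hF : LinearMap.rank (F : H →ₗ[ℂ] H) ≤ (n : Cardinal)) : sNumbers X n ≤ ‖X - F‖ :=
  csInf_le ⟨0, by rintro r ⟨G, -, rfl⟩; exact norm_nonneg _⟩ ⟨F, hF, rfl⟩

theorem le_sNumbers {X : H →L[ℂ] H} {n : ℕ} {t : ℝ}
    (h : ∀ F : H →L[ℂ] H, LinearMap.rank (F : H →ₗ[ℂ] H) ≤ (n : Cardinal) → t ≤ ‖X - F‖) :
    t ≤ sNumbers X n := by
  refine le_csInf ⟨_, 0, by simp, rfl⟩ ?_
  rintro r ⟨F, hF, rfl⟩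
  exact h F hF

theorem exists_rank_le_of_sNumbers_lt {X : H →L[ℂ] H} {n : ℕ} {r : ℝ} (h : sNumbers X n < r) :
    ∃ F : H →L[ℂ] H, LinearMap.rank (F : H →ₗ[ℂ] H) ≤ (n : Cardinal) ∧ ‖X - F‖ < r := by
  by_contra! H
  exact absurd (le_sNumbers H) (not_le.2 h)

theorem sNumbers_nonneg (X : H →L[ℂ] H) (n : ℕ) : 0 ≤ sNumbers X n :=
  le_sNumbers fun _ _ => norm_nonneg _

theorem sNumbers_antitone (X : H →L[ℂ] H) : Antitone (sNumbers X) := fun _ _ hmn =>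
  le_sNumbers fun _ hF => sNumbers_le (hF.trans (by exact_mod_cast hmn))

theorem sNumbers_add_le (X Y : H →L[ℂ] H) (n : ℕ) :
    sNumbers (X + Y) n ≤ sNumbers X (n / 2) + sNumbers Y (n / 2) := by
  refine le_of_forall_pos_lt_add fun ε hε => ?_
  obtain ⟨F, hF, hF'⟩ := exists_rank_le_of_sNumbers_lt
    (lt_add_of_pos_right (sNumbers X (n / 2)) (half_pos hε))
  obtain ⟨G, hG, hG'⟩ := exists_rank_le_of_sNumbers_lt
    (lt_add_of_pos_right (sNumbers Y (n / 2)) (half_pos hε))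
  have hFG : LinearMap.rank ((F + G : H →L[ℂ] H) : H →ₗ[ℂ] H) ≤ (n : Cardinal) := by
    refine (LinearMap.rank_add_le _ _).trans ((add_le_add hF hG).trans ?_)
    norm_cast
    omega
  calc sNumbers (X + Y) n ≤ ‖X + Y - (F + G)‖ := sNumbers_le hFG
    _ = ‖(X - F) + (Y - G)‖ := by congr 1; abel
    _ ≤ ‖X - F‖ + ‖Y - G‖ := norm_add_le _ _
    _ < _ := by linarith

theorem sNumbers_mul_le_left (A X : H →L[ℂ] H) (n : ℕ) :
    sNumbers (A * X) n ≤ ‖A‖ * sNumbers X n := by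
  rcases (norm_nonneg A).eq_or_lt with h | h
  · rw [← h, zero_mul]
    refine (sNumbers_le (F := 0) (by simp)).trans ?_
    simp [norm_eq_zero.1 h.symm]
  · rw [← div_le_iff₀' h]
    refine le_sNumbers fun F hF => ?_
    rw [div_le_iff₀' h]
    refine (sNumbers_le (F := A * F) ((LinearMap.rank_comp_le_right _ _).trans hF)).trans ?_
    rw [← mul_sub]
    exact norm_mul_le _ _

theorem sNumbers_mul_le_right (X B : H →L[ℂ] H) (n : ℕ) :
    sNumbers (X * B) n ≤ ‖B‖ * sNumbers X n := by
  rcases (norm_nonneg B).eq_or_lt with h | h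
  · rw [← h, zero_mul]
    refine (sNumbers_le (F := 0) (by simp)).trans ?_
    simp [norm_eq_zero.1 h.symm]
  · rw [← div_le_iff₀' h]
    refine le_sNumbers fun F hF => ?_
    rw [div_le_iff₀' h]
    refine (sNumbers_le (F := F * B) ((LinearMap.rank_comp_le_left _ _).trans hF)).trans ?_
    rw [← sub_mul, mul_comm]
    exact norm_mul_le _ _

theorem sNumbers_zero : sNumbers (0 : H →L[ℂ] H) = 0 := by
  funext n
  refine le_antisymm ?_ (sNumbers_nonneg _ n)
  exact (sNumbers_le (F := 0) (by simp)).trans (by simp)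

theorem sNumbers_mem_cZeroStar {X : H →L[ℂ] H} (h : ∀ δ > 0, ∃ n, sNumbers X n < δ) :
    sNumbers X ∈ cZeroStar := by
  refine ⟨sNumbers_antitone X, Metric.tendsto_atTop.2 fun δ hδ => ?_⟩
  obtain ⟨N, hN⟩ := h δ hδ
  refine ⟨N, fun n hn => ?_⟩
  rw [dist_zero_right, Real.norm_of_nonneg (sNumbers_nonneg X n)]
  exact (sNumbers_antitone X hn).trans_lt hN

theorem rank_mul_starProjection_le (X : H →L[ℂ] H) (W : Submodule ℂ H) [FiniteDimensional ℂ W]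
    {n : ℕ} (hW : Module.finrank ℂ W ≤ n) :
    LinearMap.rank ((X * W.starProjection : H →L[ℂ] H) : H →ₗ[ℂ] H) ≤ (n : Cardinal) := by
  refine (LinearMap.rank_comp_le_right (W.starProjection : H →ₗ[ℂ] H) (X : H →ₗ[ℂ] H)).trans ?_
  have h : LinearMap.range (W.starProjection : H →ₗ[ℂ] H) = W := W.range_starProjection
  rw [LinearMap.rank, h, ← Module.finrank_eq_rank]
  exact_mod_cast hW

/-- Composing X with the projection onto W gives a competitor of rank at most n; the difference is X
applied to the component in Wᗮ. This is the upper half of min-max. -/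
theorem sNumbers_le_of_forall_orthogonal {X : H →L[ℂ] H} (W : Submodule ℂ H)
    [FiniteDimensional ℂ W] {n : ℕ} (hW : Module.finrank ℂ W ≤ n) {t : ℝ} (ht : 0 ≤ t)
    (h : ∀ x ∈ Wᗮ, ‖X x‖ ≤ t * ‖x‖) : sNumbers X n ≤ t := by
  refine (sNumbers_le (rank_mul_starProjection_le X W hW)).trans ?_
  refine ContinuousLinearMap.opNorm_le_bound _ ht fun x => ?_
  have h1 : (X - X * W.starProjection) x = X (x - W.starProjection x) := by
    simp
  rw [h1]
  refine (h _ (W.sub_starProjection_mem_orthogonal x)).trans (mul_le_mul_of_nonneg_left ?_ ht)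
  rw [← W.starProjection_orthogonal_val]
  exact Wᗮ.norm_starProjection_apply_le x

theorem norm_sq_sum_smul {g : ℕ → H} (hg : Pairwise fun i j => inner ℂ (g i) (g j) = 0)
    (c : ℕ → ℂ) (s : Finset ℕ) :
    ‖∑ i ∈ s, c i • g i‖ ^ 2 = ∑ i ∈ s, ‖c i‖ ^ 2 * ‖g i‖ ^ 2 := by
  classical
  induction s using Finset.induction_on with
  | empty => simp
  | insert a s ha ih =>
    rw [Finset.sum_insert ha, Finset.sum_insert ha, ← ih]
    have : inner ℂ (c a • g a) (∑ i ∈ s, c i • g i) = 0 := by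
      rw [inner_sum]
      refine Finset.sum_eq_zero fun i hi => ?_
      rw [inner_smul_left, inner_smul_right, hg (by rintro rfl; exact ha hi)]
      simp
    have h2 := norm_add_sq_eq_norm_sq_add_norm_sq_of_inner_eq_zero _ _ this
    rw [sq, h2, ← sq, ← sq, norm_smul, mul_pow]

/-- The lower bound in the min-max principle for s-numbers. -/
theorem le_sNumbers_of_orthogonal {X : H →L[ℂ] H} {v : ℕ → H} (hv : Orthonormal ℂ v)
    (ho : Pairwise fun i j => inner ℂ (X (v i)) (X (v j)) = 0) {n : ℕ} {t : ℝ}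
    (ht : ∀ i ≤ n, t ≤ ‖X (v i)‖) : t ≤ sNumbers X n := by
  rcases le_total t 0 with h0 | h0
  · exact h0.trans (sNumbers_nonneg X n)
  refine le_sNumbers fun F hF => ?_
  -- The n + 1 vectors F(v i) are dependent since F has rank at most n, so F kills a nonzero
  -- combination x of the v i. There X - F agrees with X.
  obtain ⟨c, hc0, hcF⟩ : ∃ c : ℕ → ℂ, (∃ i ∈ Finset.range (n + 1), c i ≠ 0) ∧
      ∑ i ∈ Finset.range (n + 1), c i • F (v i) = 0 := by
    have hli : ¬ LinearIndependent ℂ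
        (fun i : Fin (n + 1) => (F : H →ₗ[ℂ] H).rangeRestrict (v i)) := by
      intro hli
      have h1 := hli.cardinal_lift_le_rank.trans (Cardinal.lift_le.2 hF)
      simp only [Cardinal.mk_fintype, Fintype.card_fin, Cardinal.lift_natCast] at h1
      norm_cast at h1
      omega
    obtain ⟨g, hg, i, hi⟩ := Fintype.not_linearIndependent_iff.1 hli
    refine ⟨fun j => if h : j < n + 1 then g ⟨j, h⟩ else 0,
      ⟨i, Finset.mem_range.2 i.2, by simpa [Nat.le_of_lt_succ i.2] using hi⟩, ?_⟩
    rw [Finset.sum_range]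
    have := congrArg Subtype.val hg
    simpa [fun j : Fin (n + 1) => Nat.le_of_lt_succ j.2] using this
  set x := ∑ i ∈ Finset.range (n + 1), c i • v i with hx
  have hFx : F x = 0 := by simpa [hx] using hcF
  have hxn : ‖x‖ ^ 2 = ∑ i ∈ Finset.range (n + 1), ‖c i‖ ^ 2 := by
    rw [hx, norm_sq_sum_smul hv.2]
    simp [hv.1]
  have hXx : ‖X x‖ ^ 2 = ∑ i ∈ Finset.range (n + 1), ‖c i‖ ^ 2 * ‖X (v i)‖ ^ 2 := by
    rw [← norm_sq_sum_smul ho]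
    simp [hx]
  have hxpos : 0 < ‖x‖ := by
    obtain ⟨i, hi, hci⟩ := hc0
    have : 0 < ‖x‖ ^ 2 := by
      rw [hxn]
      exact Finset.sum_pos' (fun _ _ => by positivity) ⟨i, hi, by positivity⟩
    exact (norm_nonneg x).lt_of_ne' fun h => by simp [h] at this
  have h1 : (t * ‖x‖) ^ 2 ≤ ‖X x‖ ^ 2 := by
    rw [mul_pow, hxn, hXx, Finset.mul_sum]
    refine Finset.sum_le_sum fun i hi => ?_
    rw [mul_comm]
    gcongr
    exact ht i (by simp at hi; omega)
  have h2 : t * ‖x‖ ≤ ‖X x‖ := (pow_le_pow_iff_left₀ (by positivity) (by positivity) two_ne_zero).1 h1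
  have h3 : ‖X x‖ ≤ ‖X - F‖ * ‖x‖ := by
    have := (X - F).le_opNorm x
    simpa [hFx] using this
  exact le_of_mul_le_mul_right (h2.trans h3) hxpos

theorem isCompactOperator_of_rank_le {F : H →L[ℂ] H} {n : ℕ}
    (hF : LinearMap.rank (F : H →ₗ[ℂ] H) ≤ (n : Cardinal)) : IsCompactOperator F := by
  have : FiniteDimensional ℂ (LinearMap.range (F : H →ₗ[ℂ] H)) :=
    Module.rank_lt_aleph0_iff.1 (hF.trans_lt (Cardinal.natCast_lt_aleph0))
  have : ProperSpace (LinearMap.range (F : H →ₗ[ℂ] H)) := FiniteDimensional.proper ℂ _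
  let G : H →L[ℂ] LinearMap.range (F : H →ₗ[ℂ] H) :=
    F.codRestrict _ fun x => ⟨x, rfl⟩
  exact (isCompactOperator_of_locallyCompactSpace_dom G).clm_comp
    (LinearMap.range (F : H →ₗ[ℂ] H)).subtypeL

theorem isCompactOperator_of_sNumbers [CompleteSpace H] {X : H →L[ℂ] H}
    (h : sNumbers X ∈ cZeroStar) : IsCompactOperator X := by
  have : ∀ n : ℕ, ∃ F : H →L[ℂ] H, LinearMap.rank (F : H →ₗ[ℂ] H) ≤ (n : Cardinal) ∧
      ‖X - F‖ < sNumbers X n + 1 / ((n : ℝ) + 1) := fun n =>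
    exists_rank_le_of_sNumbers_lt (lt_add_of_pos_right _ (by positivity))
  choose F hF hFn using this
  refine isCompactOperator_of_tendsto (F := F) (l := atTop) ?_
    (Eventually.of_forall fun n => isCompactOperator_of_rank_le (hF n))
  rw [tendsto_iff_norm_sub_tendsto_zero]
  have h0 := h.2.add (tendsto_one_div_add_atTop_nhds_zero_nat (𝕜 := ℝ))
  rw [add_zero] at h0
  refine squeeze_zero (fun _ => norm_nonneg _) (fun n => ?_) h0
  rw [norm_sub_rev]
  exact (hFn n).le

end SNumbers

/-! ### Norm-attaining vectors of compact operators -/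

section NormAttaining

variable {E F : Type*} [NormedAddCommGroup E] [InnerProductSpace ℂ E] [CompleteSpace E]
  [NormedAddCommGroup F] [InnerProductSpace ℂ F] [CompleteSpace F]

/-- Expand the square. The estimate says that near-maximisers of ‖Tv‖ are approximate eigenvectors
of T*T for ‖T‖². -/
theorem norm_adjoint_apply_sub_sq_le (T : E →L[ℂ] F) (v : E) :
    ‖T.adjoint (T v) - ((‖T‖ ^ 2 : ℝ) : ℂ) • v‖ ^ 2 ≤ ‖T‖ ^ 2 * (‖T‖ ^ 2 * ‖v‖ ^ 2 - ‖T v‖ ^ 2) := by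
  have h1 : ‖T.adjoint (T v)‖ ^ 2 ≤ ‖T‖ ^ 2 * ‖T v‖ ^ 2 := by
    rw [← mul_pow]
    gcongr
    simpa using T.adjoint.le_opNorm (T v)
  have h2 : RCLike.re (inner ℂ (T.adjoint (T v)) (((‖T‖ ^ 2 : ℝ) : ℂ) • v))
      = ‖T‖ ^ 2 * ‖T v‖ ^ 2 := by
    rw [inner_smul_right, T.adjoint_inner_left, inner_self_eq_norm_sq_to_K]
    exact (RCLike.re_ofReal_mul (K := ℂ) _ _).trans (by
      rw [← RCLike.ofReal_pow, RCLike.ofReal_re]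
      rfl)
  rw [@norm_sub_sq ℂ, h2, norm_smul, Complex.norm_real, Real.norm_of_nonneg (by positivity)]
  nlinarith

/-- A compact operator attains its norm at a unit vector, and it preserves orthogonality to such
a vector. -/
theorem exists_norm_attaining [Nontrivial E] {T : E →L[ℂ] F} (hT : IsCompactOperator T) :
    ∃ e : E, ‖e‖ = 1 ∧ (∀ x, ‖T x‖ ≤ ‖T e‖ * ‖x‖) ∧
      ∀ x, inner ℂ e x = 0 → inner ℂ (T e) (T x) = 0 := by
  suffices ∃ e : E, ‖e‖ = 1 ∧ ‖T e‖ = ‖T‖ by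
    obtain ⟨e, he, hTe⟩ := this
    refine ⟨e, he, fun x => hTe ▸ T.le_opNorm x, fun x hx => ?_⟩
    -- At a maximiser the bound is zero, so e is an eigenvector of T*T; orthogonality to e then
    -- passes to the images.
    have h := norm_adjoint_apply_sub_sq_le T e
    rw [he, hTe, one_pow, mul_one, sub_self, mul_zero] at h
    have h0 : T.adjoint (T e) = ((‖T‖ ^ 2 : ℝ) : ℂ) • e := by
      rw [← sub_eq_zero, ← norm_eq_zero]
      exact pow_eq_zero_iff two_ne_zero |>.1 (le_antisymm h (by positivity))
    rw [← T.adjoint_inner_left, h0, inner_smul_left, hx, mul_zero]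
  rcases (norm_nonneg T).eq_or_lt with h0 | hpos
  · obtain ⟨e, he⟩ := exists_norm_eq E zero_le_one
    exact ⟨e, he, by simp [norm_eq_zero.1 h0.symm]⟩
  have hex : ∀ n : ℕ, ∃ v : E, ‖v‖ < 1 ∧ ‖T‖ - 1 / ((n : ℝ) + 1) < ‖T v‖ := fun n =>
    T.exists_lt_apply_of_lt_opNorm (sub_lt_self _ (by positivity))
  choose v hv1 hvT using hex
  have hle : ∀ n, ‖T (v n)‖ ≤ ‖T‖ := fun n =>
    (T.le_opNorm _).trans (mul_le_of_le_one_right hpos.le (hv1 n).le)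
  have hlim : Tendsto (fun n => ‖T (v n)‖) atTop (𝓝 ‖T‖) := by
    refine tendsto_of_tendsto_of_tendsto_of_le_of_le (g := fun n : ℕ => ‖T‖ - 1 / ((n : ℝ) + 1))
      ?_ tendsto_const_nhds (fun n => (hvT n).le) hle
    simpa using tendsto_const_nhds.sub (tendsto_one_div_add_atTop_nhds_zero_nat (𝕜 := ℝ))
  obtain ⟨w, -, φ, hφ, hw⟩ :=
    (IsCompactOperator.isCompact_closure_image_closedBall (f := (T : E →ₗ[ℂ] F)) hT 1).tendsto_subseq
      (x := fun n => T (v n)) fun n =>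
        subset_closure ⟨v n, by simpa using (hv1 n).le, rfl⟩
  have hsub : Tendsto (fun n => T.adjoint (T (v (φ n))) - ((‖T‖ ^ 2 : ℝ) : ℂ) • v (φ n))
      atTop (𝓝 0) := by
    rw [tendsto_zero_iff_norm_tendsto_zero]
    have : Tendsto (fun n => ‖T‖ ^ 2 * (‖T‖ ^ 2 * 1 ^ 2 - ‖T (v (φ n))‖ ^ 2)) atTop (𝓝 0) := by
      have := ((tendsto_const_nhds (x := ‖T‖ ^ 2 * 1 ^ 2)).sub
        ((hlim.comp hφ.tendsto_atTop).pow 2)).const_mul (‖T‖ ^ 2)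
      simpa using this
    have h2 := squeeze_zero (fun n => by positivity) (fun n =>
      (norm_adjoint_apply_sub_sq_le T (v (φ n))).trans (by
        gcongr
        exact (hv1 _).le)) this
    have h3 := h2.sqrt
    simpa using h3
  -- Compactness makes T v converge along `φ`; since T*Tv - ‖T‖²v tends to 0 and ‖T‖ is nonzero, v
  -- itself converges.
  have hconv : Tendsto (fun n => v (φ n)) atTop
      (𝓝 ((((‖T‖ ^ 2 : ℝ) : ℂ))⁻¹ • T.adjoint w)) := by
    have h1 := (((T.adjoint.continuous.tendsto w).comp hw).sub hsub).const_smul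
      (((‖T‖ ^ 2 : ℝ) : ℂ))⁻¹
    have hne : ((‖T‖ ^ 2 : ℝ) : ℂ) ≠ 0 := by
      exact_mod_cast (by positivity : ‖T‖ ^ 2 ≠ 0)
    simpa only [Function.comp_apply, sub_sub_cancel, inv_smul_smul₀ hne, sub_zero] using h1
  set e := (((‖T‖ ^ 2 : ℝ) : ℂ))⁻¹ • T.adjoint w
  have hTe : ‖T e‖ = ‖T‖ := tendsto_nhds_unique
    (((T.continuous.tendsto e).comp hconv).norm) (hlim.comp hφ.tendsto_atTop)
  have he1 : ‖e‖ ≤ 1 := le_of_tendsto hconv.norm (Eventually.of_forall fun n => (hv1 _).le)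
  refine ⟨e, le_antisymm he1 ?_, hTe⟩
  have := T.le_opNorm e
  rw [hTe] at this
  exact le_of_mul_le_mul_left (by simpa using this) hpos

end NormAttaining

/-! ### Schmidt decomposition and orthonormal sequences -/

section Schmidt

variable {H : Type*} [NormedAddCommGroup H] [InnerProductSpace ℂ H]

/-- An orthonormal sequence in which the `n`-th vector satisfies a property relative to the span
of the preceding ones. -/
theorem exists_orthonormal_seq {P : Submodule ℂ H → H → Prop}
    (h : ∀ W : Submodule ℂ H, FiniteDimensional ℂ W → ∃ e ∈ Wᗮ, ‖e‖ = 1 ∧ P W e) :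
    ∃ e : ℕ → H, Orthonormal ℂ e ∧
      ∀ n, P (Submodule.span ℂ (e '' Set.Iio n)) (e n) := by
  have h' : ∀ W : Submodule ℂ H, ∃ e, FiniteDimensional ℂ W → e ∈ Wᗮ ∧ ‖e‖ = 1 ∧ P W e := by
    intro W
    by_cases hW : FiniteDimensional ℂ W
    · obtain ⟨e, he⟩ := h W hW
      exact ⟨e, fun _ => he⟩
    · exact ⟨0, fun h0 => absurd h0 hW⟩
  choose step hstep using h'
  let W : ℕ → Submodule ℂ H := fun n =>
    Nat.rec ⊥ (fun _ V => V ⊔ Submodule.span ℂ {step V}) n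
  have hW : ∀ n, W n = Submodule.span ℂ ((fun k => step (W k)) '' Set.Iio n) := by
    intro n
    induction n with
    | zero => simp [W]
    | succ n ih =>
      have h1 : W (n + 1) = W n ⊔ Submodule.span ℂ {step (W n)} := rfl
      have h2 : Set.Iio (n + 1) = insert n (Set.Iio n) := by
        ext i
        simp
      rw [h1, h2, Set.image_insert_eq, Submodule.span_insert, ← ih, sup_comm]
  have hfd : ∀ n (V : Submodule ℂ H), V = Submodule.span ℂ ((fun k => step (W k)) '' Set.Iio n) →
      FiniteDimensional ℂ V := by
    rintro n _ rfl
    exact FiniteDimensional.span_of_finite ℂ ((Set.finite_Iio n).image _)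
  refine ⟨fun n => step (W n), ⟨fun n => (hstep _ (hfd n _ (hW n))).2.1, ?_⟩, fun n => ?_⟩
  · have key : ∀ i j, i < j → inner ℂ (step (W i)) (step (W j)) = 0 := fun i j hij =>
      (Submodule.mem_orthogonal _ _).1 (hstep _ (hfd j _ (hW j))).1 _ (by
        rw [hW j]
        exact Submodule.subset_span ⟨i, hij, rfl⟩)
    intro i j hij
    rcases lt_or_gt_of_ne hij with h1 | h1
    · exact key i j h1
    · exact inner_eq_zero_symm.1 (key j i h1)
  · rw [← hW n]
    exact (hstep _ (hfd n _ (hW n))).2.2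

theorem finrank_span_image_Iio_le (e : ℕ → H) (n : ℕ) :
    Module.finrank ℂ (Submodule.span ℂ (e '' Set.Iio n)) ≤ n := by
  classical
  have h : e '' Set.Iio n = ((Finset.range n).image e : Finset H) := by simp
  rw [h]
  exact (finrank_span_finset_le_card _).trans
    (Finset.card_image_le.trans_eq (Finset.card_range n))

theorem mem_orthogonal_span_image {e : ℕ → H} {n : ℕ} {x : H} :
    x ∈ (Submodule.span ℂ (e '' Set.Iio n))ᗮ ↔ ∀ i < n, inner ℂ (e i) x = 0 := by
  rw [Submodule.mem_orthogonal]
  refine ⟨fun h i hi => h _ (Submodule.subset_span ⟨i, hi, rfl⟩), fun h y hy => ?_⟩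
  induction hy using Submodule.span_induction with
  | mem y hy => obtain ⟨i, hi, rfl⟩ := hy; exact h i hi
  | zero => simp
  | add y z _ _ hy hz => rw [inner_add_left, hy, hz, add_zero]
  | smul c y _ hy => rw [inner_smul_left, hy, mul_zero]

theorem nontrivial_orthogonal (hH : ¬ FiniteDimensional ℂ H) (W : Submodule ℂ H)
    [FiniteDimensional ℂ W] : Nontrivial Wᗮ := by
  rw [Submodule.nontrivial_iff_ne_bot]
  intro h
  rw [Submodule.orthogonal_eq_bot_iff] at h
  subst h
  exact hH (Module.Finite.equiv (Submodule.topEquiv (R := ℂ) (M := H)))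

variable [CompleteSpace H]

/-- Greedy choice: each e n attains the norm of X on the orthogonal complement of its predecessors.
The two halves of min-max identify ‖X (e n)‖ with the n-th s-number; a vector orthogonal to all e n
satisfies ‖Xx‖ ≤ s_n‖x‖ for every n. -/
theorem exists_schmidt (hH : ¬ FiniteDimensional ℂ H) {X : H →L[ℂ] H}
    (hX : sNumbers X ∈ cZeroStar) :
    ∃ e : ℕ → H, Orthonormal ℂ e ∧ (Pairwise fun i j => inner ℂ (X (e i)) (X (e j)) = 0) ∧
      (∀ n, ‖X (e n)‖ = sNumbers X n) ∧ ∀ x, (∀ n, inner ℂ (e n) x = 0) → X x = 0 := by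
  have hc := isCompactOperator_of_sNumbers hX
  obtain ⟨e, he, hP⟩ := exists_orthonormal_seq (P := fun W e =>
      (∀ x ∈ Wᗮ, ‖X x‖ ≤ ‖X e‖ * ‖x‖) ∧
      ∀ x ∈ Wᗮ, inner ℂ e x = 0 → inner ℂ (X e) (X x) = 0) (by
    intro W hW
    have := nontrivial_orthogonal hH W
    obtain ⟨e, he, h1, h2⟩ := exists_norm_attaining (T := X ∘L Wᗮ.subtypeL)
      (hc.comp_clm Wᗮ.subtypeL)
    exact ⟨e, e.2, he, fun x hx => h1 ⟨x, hx⟩, fun x hx => h2 ⟨x, hx⟩⟩)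
  simp only [mem_orthogonal_span_image] at hP
  have ho : Pairwise fun i j => inner ℂ (X (e i)) (X (e j)) = 0 := by
    have key : ∀ i j, i < j → inner ℂ (X (e i)) (X (e j)) = 0 := fun i j hij =>
      (hP i).2 (e j) (fun k hk => he.2 (by omega)) (he.2 hij.ne)
    intro i j hij
    rcases lt_or_gt_of_ne hij with h1 | h1
    · exact key i j h1
    · exact inner_eq_zero_symm.1 (key j i h1)
  have hs : ∀ n, ‖X (e n)‖ = sNumbers X n := by
    intro n
    refine le_antisymm (le_sNumbers_of_orthogonal he ho fun i hi => ?_) ?_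
    · simpa [he.1] using (hP i).1 (e n) fun k hk => he.2 (by omega)
    · have hfd : FiniteDimensional ℂ (Submodule.span ℂ (e '' Set.Iio n)) :=
        FiniteDimensional.span_of_finite ℂ ((Set.finite_Iio n).image _)
      exact sNumbers_le_of_forall_orthogonal _ (finrank_span_image_Iio_le e n)
        (norm_nonneg _) fun x hx => (hP n).1 x (mem_orthogonal_span_image.1 hx)
  refine ⟨e, he, ho, hs, fun x hx => ?_⟩
  have h0 : Tendsto (fun n => sNumbers X n * ‖x‖) atTop (𝓝 0) := by
    simpa using hX.2.mul_const ‖x‖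
  exact norm_le_zero_iff.1 (ge_of_tendsto' h0 fun n => hs n ▸ (hP n).1 x fun i _ => hx i)

/-- Without compactness the norm need not be attained; settling for δ/2 < δ leaves a suitable vector
in every subspace of finite codimension. -/
theorem exists_orthonormal_of_le_sNumbers {X : H →L[ℂ] H} {δ : ℝ} (hδ : 0 < δ)
    (hX : ∀ n, δ ≤ sNumbers X n) :
    ∃ e : ℕ → H, Orthonormal ℂ e ∧ (Pairwise fun i j => inner ℂ (X (e i)) (X (e j)) = 0) ∧
      ∀ n, δ / 2 ≤ ‖X (e n)‖ := by
  obtain ⟨e, he, hP⟩ := exists_orthonormal_seq (P := fun W e =>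
      δ / 2 ≤ ‖X e‖ ∧ ∀ y ∈ W, inner ℂ (X y) (X e) = 0) (by
    intro W hW
    -- Orthogonality to X*Xy for y in W is what makes Xx orthogonal to Xy.
    set V : Submodule ℂ H := W ⊔ W.map ((X.adjoint ∘L X : H →L[ℂ] H) : H →ₗ[ℂ] H) with hV
    have : ∃ x ∈ Vᗮ, δ / 2 * ‖x‖ < ‖X x‖ := by
      by_contra! h
      have := sNumbers_le_of_forall_orthogonal V le_rfl (by positivity) h
      linarith [hX (Module.finrank ℂ V)]
    obtain ⟨x, hx, hxX⟩ := this
    have hx0 : x ≠ 0 := by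
      rintro rfl
      simp at hxX
    have hxn : 0 < ‖x‖ := norm_pos_iff.2 hx0
    have hxV := (Submodule.mem_orthogonal _ _).1 hx
    refine ⟨((‖x‖⁻¹ : ℝ) : ℂ) • x, ?_, ?_, ?_, fun y hy => ?_⟩
    · exact Wᗮ.smul_mem _ (Submodule.orthogonal_le le_sup_left hx)
    · rw [norm_smul, Complex.norm_real, norm_inv, norm_norm, inv_mul_cancel₀ hxn.ne']
    · rw [map_smul, norm_smul, Complex.norm_real, norm_inv, norm_norm, inv_mul_eq_div,
        le_div_iff₀ hxn]
      exact hxX.le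
    · have := hxV (X.adjoint (X y)) (Submodule.mem_sup_right ⟨y, hy, rfl⟩)
      rw [X.adjoint_inner_left] at this
      rw [map_smul, inner_smul_right, this, mul_zero])
  refine ⟨e, he, ?_, fun n => (hP n).1⟩
  have key : ∀ i j, i < j → inner ℂ (X (e i)) (X (e j)) = 0 := fun i j hij =>
    (hP j).2 _ (Submodule.subset_span ⟨i, hij, rfl⟩)
  intro i j hij
  rcases lt_or_gt_of_ne hij with h1 | h1
  · exact key i j h1
  · exact inner_eq_zero_symm.1 (key j i h1)

theorem exists_hilbertBasis_nat [TopologicalSpace.SeparableSpace H]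
    (hH : ¬ FiniteDimensional ℂ H) : Nonempty (HilbertBasis ℕ ℂ H) := by
  obtain ⟨w, b, hb⟩ := exists_hilbertBasis ℂ H
  have hdist : ∀ i j : w, i ≠ j → 1 ≤ dist (i : H) j := by
    intro i j hij
    have h1 := b.orthonormal
    have h2 : ‖b i - b j‖ * ‖b i - b j‖ = 1 * 1 + 1 * 1 := by
      rw [@norm_sub_mul_self ℂ, h1.1, h1.1, h1.2 hij]
      simp
    rw [hb] at h2
    rw [dist_eq_norm]
    nlinarith [norm_nonneg ((i : H) - j)]
  have hcount : Countable w := by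
    have : w.PairwiseDisjoint fun x => Metric.ball x (1 / 2) := by
      intro x hx y hy hxy
      refine Metric.ball_disjoint_ball ?_
      have := hdist ⟨x, hx⟩ ⟨y, hy⟩ (by simpa using hxy)
      norm_num at this ⊢
      exact this
    -- Separability allows only countably many disjoint nonempty open balls.
    exact (this.countable_of_isOpen (fun _ _ => Metric.isOpen_ball)
      fun x _ => ⟨x, Metric.mem_ball_self (by norm_num)⟩).to_subtype
  have hinf : Infinite w := by
    by_contra hfin
    rw [not_infinite_iff_finite] at hfin
    have := Fintype.ofFinite w
    exact hH (Module.Finite.of_basis b.toOrthonormalBasis.toBasis)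
  obtain ⟨φ⟩ : Nonempty (ℕ ≃ w) := inferInstance
  refine ⟨HilbertBasis.mk (v := fun n => b (φ n)) (b.orthonormal.comp φ φ.injective) ?_⟩
  have : Set.range (fun n => b (φ n)) = Set.range b := φ.surjective.range_comp b
  rw [this, b.dense_span]

end Schmidt

/-! ### Diagonal operators in a Hilbert basis -/

section Basis

variable {H : Type*} [NormedAddCommGroup H] [InnerProductSpace ℂ H]
  (u : HilbertBasis ℕ ℂ H)

theorem pairwise_inner_smul {g : ℕ → H} (hg : Pairwise fun i j => inner ℂ (g i) (g j) = 0)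
    (c : ℕ → ℂ) : Pairwise fun i j => inner ℂ (c i • g i) (c j • g j) = 0 := fun i j hij => by
  change inner ℂ (c i • g i) (c j • g j) = 0
  rw [inner_smul_left, inner_smul_right, hg hij, mul_zero, mul_zero]

theorem clm_ext_hilbertBasis {A B : H →L[ℂ] H} (h : ∀ n, A (u n) = B (u n)) : A = B := by
  refine ContinuousLinearMap.ext_on (s := Set.range u)
    (Submodule.dense_iff_topologicalClosure_eq_top.2 u.dense_span) ?_
  rintro _ ⟨n, rfl⟩
  exact h n

theorem eq_of_forall_inner_hilbertBasis {x y : H} (h : ∀ n, inner ℂ (u n) x = inner ℂ (u n) y) :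
    x = y := by
  apply u.repr.injective
  ext n
  simpa [u.repr_apply_apply] using h n

/-- An operator which is diagonal in the basis `u`, with real entries `ξ`. -/
def IsDiag (D : H →L[ℂ] H) (ξ : ℕ → ℝ) : Prop :=
  ∀ n, D (u n) = (ξ n : ℂ) • u n

theorem IsDiag.unique {u : HilbertBasis ℕ ℂ H} {D D' : H →L[ℂ] H} {ξ : ℕ → ℝ} (h : IsDiag u D ξ) (h' : IsDiag u D' ξ) :
    D = D' :=
  clm_ext_hilbertBasis u fun n => by rw [h n, h' n]

theorem IsDiag.mul {u : HilbertBasis ℕ ℂ H} {D D' : H →L[ℂ] H} {ξ η : ℕ → ℝ} (h : IsDiag u D ξ) (h' : IsDiag u D' η) :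
    IsDiag u (D * D') (fun n => ξ n * η n) := fun n => by
  rw [mul_apply_eq_comp, h' n, map_smul, h n, smul_smul, mul_comm]
  push_cast
  rfl

theorem IsDiag.add {u : HilbertBasis ℕ ℂ H} {D D' : H →L[ℂ] H} {ξ η : ℕ → ℝ} (h : IsDiag u D ξ) (h' : IsDiag u D' η) :
    IsDiag u (D + D') (ξ + η) := fun n => by
  rw [add_apply, h n, h' n, ← add_smul]
  push_cast [Pi.add_apply]
  rfl

variable [CompleteSpace H]

/-- The series of (u i, x) g i converges and is bounded by C‖x‖, by Pythagoras for the orthogonal g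
i and Bessel's inequality for u. -/
theorem exists_clm_apply_hilbertBasis {g : ℕ → H}
    (hg : Pairwise fun i j => inner ℂ (g i) (g j) = 0) {C : ℝ} (hC : ∀ n, ‖g n‖ ≤ C) :
    ∃ A : H →L[ℂ] H, (∀ n, A (u n) = g n) ∧ ‖A‖ ≤ C := by
  have hC0 : 0 ≤ C := (norm_nonneg _).trans (hC 0)
  have hbd : ∀ (x : H) (s : Finset ℕ),
      ‖∑ i ∈ s, (inner ℂ (u i) x : ℂ) • g i‖ ≤ C * ‖x‖ := by
    intro x s
    refine (pow_le_pow_iff_left₀ (norm_nonneg _) (by positivity) two_ne_zero).1 ?_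
    rw [norm_sq_sum_smul hg, mul_pow]
    calc _ ≤ ∑ i ∈ s, ‖(inner ℂ (u i) x : ℂ)‖ ^ 2 * C ^ 2 := by
          gcongr with i
          exact hC i
      _ = C ^ 2 * ∑ i ∈ s, ‖(inner ℂ (u i) x : ℂ)‖ ^ 2 := by rw [← Finset.sum_mul, mul_comm]
      _ ≤ _ := by
          gcongr
          exact u.orthonormal.sum_inner_products_le x
  have hsum : ∀ x : H, Summable fun i => (inner ℂ (u i) x : ℂ) • g i := by
    intro x
    have hV : OrthogonalFamily ℂ (fun i => Submodule.span ℂ {g i})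
        fun i => (Submodule.span ℂ {g i}).subtypeₗᵢ := by
      refine OrthogonalFamily.of_pairwise fun i j hij => ?_
      simp only [Function.onFun]
      rw [Submodule.isOrtho_span]
      rintro _ rfl _ rfl
      exact hg hij
    refine (hV.summable_iff_norm_sq_summable fun i =>
      ⟨(inner ℂ (u i) x : ℂ) • g i, Submodule.smul_mem _ _ (Submodule.mem_span_singleton_self _)⟩).2 ?_
    refine Summable.of_nonneg_of_le (fun _ => by positivity) (fun i => ?_)
      ((u.orthonormal.inner_products_summable x).mul_right (C ^ 2))
    simp only [Submodule.coe_norm, norm_smul, mul_pow]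
    gcongr
    exact hC i
  let L : H →ₗ[ℂ] H :=
    { toFun := fun x => ∑' i, (inner ℂ (u i) x : ℂ) • g i
      map_add' := fun x y => by
        rw [← (hsum x).tsum_add (hsum y)]
        simp [add_smul]
      map_smul' := fun c x => by
        rw [RingHom.id_apply, ← (hsum x).tsum_const_smul]
        simp [mul_smul] }
  have hL : ∀ x, ‖L x‖ ≤ C * ‖x‖ := fun x =>
    le_of_tendsto (hsum x).hasSum.norm (Eventually.of_forall (hbd x))
  refine ⟨L.mkContinuous C hL, fun n => ?_, L.mkContinuous_norm_le hC0 hL⟩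
  change ∑' i, (inner ℂ (u i) (u n) : ℂ) • g i = g n
  rw [tsum_eq_single n]
  · simp [u.orthonormal.1]
  · intro i hi
    rw [u.orthonormal.2 hi, zero_smul]

theorem exists_isDiag {ξ : ℕ → ℝ} {C : ℝ} (hC : ∀ n, |ξ n| ≤ C) :
    ∃ D : H →L[ℂ] H, IsDiag u D ξ ∧ ‖D‖ ≤ C := by
  refine exists_clm_apply_hilbertBasis u (pairwise_inner_smul u.orthonormal.2 _) fun n => ?_
  rw [norm_smul, u.orthonormal.1, Complex.norm_real]
  simpa using hC n

theorem exists_isDiag_of_mem {ξ : ℕ → ℝ} (h : ξ ∈ cZeroStar) :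
    ∃ D : H →L[ℂ] H, IsDiag u D ξ := by
  obtain ⟨D, hD, -⟩ := exists_isDiag u (C := ξ 0) fun n => by
    rw [abs_of_nonneg (cZeroStar.nonneg h n)]
    exact h.1 (Nat.zero_le n)
  exact ⟨D, hD⟩

variable {u}

theorem IsDiag.sNumbers_eq {D : H →L[ℂ] H} {ξ : ℕ → ℝ} (hξ : ξ ∈ cZeroStar)
    (hD : IsDiag u D ξ) : sNumbers D = ξ := by
  have hpos := cZeroStar.nonneg hξ
  funext n
  refine le_antisymm ?_ ?_
  -- G is D with its first n entries erased: it has norm at most ξ n and agrees with D orthogonally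
  -- to the first n basis vectors.
  · obtain ⟨G, hG, hGn⟩ := exists_isDiag u (ξ := fun i => if i < n then 0 else ξ i) (C := ξ n)
      fun i => by
        split_ifs with h
        · simpa using hpos n
        · rw [abs_of_nonneg (hpos i)]
          exact hξ.1 (not_lt.1 h)
    have hfd : FiniteDimensional ℂ (Submodule.span ℂ (u '' Set.Iio n)) :=
      FiniteDimensional.span_of_finite ℂ ((Set.finite_Iio n).image _)
    refine sNumbers_le_of_forall_orthogonal _ (finrank_span_image_Iio_le u n) (hpos n)
      fun x hx => ?_
    rw [mem_orthogonal_span_image] at hx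
    have hs := u.hasSum_repr x
    have hDG : (fun i => D (u.repr x i • u i)) = fun i => G (u.repr x i • u i) := by
      funext i
      rw [map_smul, map_smul, hD i, hG i, u.repr_apply_apply]
      by_cases h : i < n
      · simp [hx i h]
      · simp [h]
    have h1 := D.hasSum hs
    have : D x = G x := h1.unique (hDG ▸ G.hasSum hs)
    rw [this]
    exact (G.le_opNorm x).trans (by gcongr)
  · refine le_sNumbers_of_orthogonal u.orthonormal ?_ fun i hi => ?_
    · simp only [hD _]
      exact pairwise_inner_smul u.orthonormal.2 _
    · rw [hD i, norm_smul, u.orthonormal.1, Complex.norm_real, mul_one]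
      exact (hξ.1 hi).trans (le_abs_self _)

/-- An operator acting orthogonally on an orthonormal sequence can be compressed to a diagonal
operator. -/
theorem exists_isDiag_mul_mul (X : H →L[ℂ] H) {e : ℕ → H} (he : Orthonormal ℂ e)
    (ho : Pairwise fun i j => inner ℂ (X (e i)) (X (e j)) = 0) :
    ∃ A B : H →L[ℂ] H, IsDiag u (A * X * B) (fun n => ‖X (e n)‖) := by
  obtain ⟨B, hB, -⟩ := exists_clm_apply_hilbertBasis u he.2 fun n => (he.1 n).le
  -- Since 0⁻¹ = 0, vanishing X (e n) are sent to zero and the bound 1 still holds.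
  obtain ⟨J, hJ, -⟩ := exists_clm_apply_hilbertBasis u (C := 1)
    (g := fun n => ((‖X (e n)‖⁻¹ : ℝ) : ℂ) • X (e n))
    (pairwise_inner_smul ho _)
    (fun n => by
      rw [norm_smul, Complex.norm_real, norm_inv, norm_norm]
      exact inv_mul_le_one)
  refine ⟨J.adjoint, B, fun n => eq_of_forall_inner_hilbertBasis u fun m => ?_⟩
  rw [mul_apply_eq_comp, mul_apply_eq_comp, hB,
    J.adjoint_inner_right, hJ, inner_smul_left, inner_smul_right]
  rcases eq_or_ne m n with rfl | hmn
  · rw [inner_self_eq_norm_sq_to_K, inner_self_eq_norm_sq_to_K, u.orthonormal.1]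
    rcases eq_or_ne ‖X (e m)‖ 0 with h0 | h0
    · simp [h0]
    · have : (‖X (e m)‖ : ℂ) ≠ 0 := by exact_mod_cast h0
      simp
      field_simp
  · rw [ho hmn, u.orthonormal.2 hmn]
    simp

theorem exists_eq_mul_isDiag_mul {X : H →L[ℂ] H} {e : ℕ → H} (he : Orthonormal ℂ e)
    (ho : Pairwise fun i j => inner ℂ (X (e i)) (X (e j)) = 0)
    (hker : ∀ x, (∀ n, inner ℂ (e n) x = 0) → X x = 0) :
    ∃ A B D : H →L[ℂ] H, IsDiag u D (fun n => ‖X (e n)‖) ∧ X = A * D * B := by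
  obtain ⟨J, hJ, -⟩ := exists_clm_apply_hilbertBasis u he.2 fun n => (he.1 n).le
  obtain ⟨A, hA, -⟩ := exists_clm_apply_hilbertBasis u (C := 1)
    (g := fun n => ((‖X (e n)‖⁻¹ : ℝ) : ℂ) • X (e n))
    (pairwise_inner_smul ho _)
    (fun n => by
      rw [norm_smul, Complex.norm_real, norm_inv, norm_norm]
      exact inv_mul_le_one)
  obtain ⟨D, hD, -⟩ := exists_isDiag u (ξ := fun n => ‖X (e n)‖) (C := ‖X‖) fun n => by
    rw [abs_of_nonneg (norm_nonneg _)]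
    simpa [he.1] using X.le_opNorm (e n)
  refine ⟨A, J.adjoint, D, hD, ?_⟩
  have hJe : ∀ n, J.adjoint (e n) = u n := fun n =>
    eq_of_forall_inner_hilbertBasis u fun m => by
      rw [J.adjoint_inner_right, hJ]
      rcases eq_or_ne m n with rfl | hmn
      · rw [inner_self_eq_norm_sq_to_K, inner_self_eq_norm_sq_to_K, he.1, u.orthonormal.1]
      · rw [he.2 hmn, u.orthonormal.2 hmn]
  have hXJ : X * J = A * D * J.adjoint * J := by
    refine clm_ext_hilbertBasis u fun n => ?_
    simp only [mul_apply_eq_comp, hJ, hJe, hD n, map_smul, hA, smul_smul]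
    rcases eq_or_ne ‖X (e n)‖ 0 with h0 | h0
    · simp [norm_eq_zero.1 h0]
    · rw [← Complex.ofReal_mul, mul_inv_cancel₀ h0]
      simp
  ext x
  -- J J* projects onto the closed span of the e n, so X kills x - J J* x and is determined by X J.
  have hz : ∀ n, inner ℂ (e n) (x - J (J.adjoint x)) = 0 := fun n => by
    rw [inner_sub_right, ← J.adjoint_inner_left, hJe, J.adjoint_inner_right, hJ,
      sub_self]
  have h1 := hker _ hz
  have h2 : J.adjoint (x - J (J.adjoint x)) = 0 := eq_of_forall_inner_hilbertBasis u fun m => by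
    rw [J.adjoint_inner_right, hJ, hz, inner_zero_right]
  rw [map_sub, sub_eq_zero] at h1 h2
  have h3 := congrArg (fun T : H →L[ℂ] H => T (J.adjoint x)) hXJ
  simp only [mul_apply_eq_comp] at h3 ⊢
  rw [h1, h3, ← h2]

end Basis

/-! ### Calkin's correspondence -/

section Ideals

variable {H : Type*} [NormedAddCommGroup H] [InnerProductSpace ℂ H] [CompleteSpace H]
  [TopologicalSpace.SeparableSpace H] {I : TwoSidedIdeal (H →L[ℂ] H)}

/-- Compress X to its diagonal, multiply by the bounded diagonal of ratios of s-numbers, and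
reassemble Y. -/
theorem mem_of_sNumbers_le (hH : ¬ FiniteDimensional ℂ H) {X Y : H →L[ℂ] H} (hXI : X ∈ I)
    (hX : sNumbers X ∈ cZeroStar) (hY : sNumbers Y ∈ cZeroStar) (C : ℝ)
    (h : ∀ n, sNumbers Y n ≤ C * sNumbers X n) : Y ∈ I := by
  obtain ⟨u⟩ := exists_hilbertBasis_nat hH
  obtain ⟨e, he, heo, heX, -⟩ := exists_schmidt hH hX
  obtain ⟨f, hf, hfo, hfY, hfk⟩ := exists_schmidt hH hY
  obtain ⟨A, B, hAB⟩ := exists_isDiag_mul_mul (u := u) X he heo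
  obtain ⟨A', B', D, hD, hYD⟩ := exists_eq_mul_isDiag_mul (u := u) hf hfo hfk
  simp only [heX] at hAB
  simp only [hfY] at hD
  obtain ⟨M, hM, -⟩ := exists_isDiag u (ξ := fun n => sNumbers Y n / sNumbers X n) (C := |C|)
    fun n => by
      rw [abs_of_nonneg (div_nonneg (sNumbers_nonneg Y n) (sNumbers_nonneg X n))]
      exact div_le_of_le_mul₀ (sNumbers_nonneg X n) (abs_nonneg C)
        ((h n).trans (mul_le_mul_of_nonneg_right (le_abs_self C) (sNumbers_nonneg X n)))
  have hDM : D = M * (A * X * B) := by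
    refine hD.unique ?_
    have h1 := hM.mul hAB
    have h2 : (fun n => sNumbers Y n / sNumbers X n * sNumbers X n) = sNumbers Y := by
      funext n
      -- Where s_n(X) = 0 the ratio is 0 by convention, and `h` forces s_n(Y) = 0 too.
      rcases eq_or_ne (sNumbers X n) 0 with h0 | h0
      · have := h n
        rw [h0, mul_zero] at this
        rw [h0, mul_zero, le_antisymm this (sNumbers_nonneg Y n)]
      · rw [div_mul_cancel₀ _ h0]
    rwa [h2] at h1
  rw [hYD, hDM]
  exact I.mul_mem_right _ _ (I.mul_mem_left _ _ (I.mul_mem_left _ _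
    (I.mul_mem_right _ _ (I.mul_mem_left _ _ hXI))))

/-- Otherwise X compresses to a diagonal operator bounded below, whose inverse puts 1 in I. -/
theorem sNumbers_mem_cZeroStar_of_mem (hH : ¬ FiniteDimensional ℂ H) (hI : I ≠ ⊤)
    {X : H →L[ℂ] H} (hX : X ∈ I) : sNumbers X ∈ cZeroStar := by
  refine sNumbers_mem_cZeroStar fun δ hδ => ?_
  by_contra! hn
  obtain ⟨u⟩ := exists_hilbertBasis_nat hH
  obtain ⟨e, he, ho, hX2⟩ := exists_orthonormal_of_le_sNumbers hδ hn
  obtain ⟨A, B, hAB⟩ := exists_isDiag_mul_mul (u := u) X he ho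
  obtain ⟨M, hM, -⟩ := exists_isDiag u (ξ := fun n => ‖X (e n)‖⁻¹) (C := (δ / 2)⁻¹) fun n => by
    rw [abs_of_nonneg (by positivity)]
    exact inv_anti₀ (by positivity) (hX2 n)
  have h1 : M * (A * X * B) = 1 := clm_ext_hilbertBasis u fun n => by
    have h0 : ‖X (e n)‖ ≠ 0 := ((half_pos hδ).trans_le (hX2 n)).ne'
    rw [hM.mul hAB n]
    simp [h0]
  refine hI ((TwoSidedIdeal.one_mem_iff I).1 (h1 ▸ ?_))
  exact I.mul_mem_left _ _ (I.mul_mem_right _ _ (I.mul_mem_left _ _ hX))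

theorem mem_iff_sNumbers_mem_charSet (hH : ¬ FiniteDimensional ℂ H) (hI : I ≠ ⊤)
    {X : H →L[ℂ] H} : X ∈ I ↔ sNumbers X ∈ charSet I := by
  refine ⟨fun h => ⟨X, h, rfl⟩, fun ⟨Y, hY, hYX⟩ => ?_⟩
  have hc := sNumbers_mem_cZeroStar_of_mem hH hI hY
  exact mem_of_sNumbers_le hH hY hc (hYX ▸ hc) 1 fun n => by simp [hYX]

omit [TopologicalSpace.SeparableSpace H] in
-- V and W copy the basis onto its even and odd members, so D' is two orthogonal copies of D.
theorem exists_isometries_isDiag_dilate (u : HilbertBasis ℕ ℂ H) {D D' : H →L[ℂ] H} {ξ : ℕ → ℝ}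
    (hD : IsDiag u D ξ) (hD' : IsDiag u D' (fun n => ξ (n / 2))) :
    ∃ V W : H →L[ℂ] H, D' = V * D * V.adjoint + W * D * W.adjoint := by
  have hinj : ∀ {φ : ℕ → ℕ}, φ.Injective → Pairwise fun i j => inner ℂ (u (φ i)) (u (φ j)) = 0 :=
    fun hφ i j hij => u.orthonormal.2 (hφ.ne hij)
  have hadj : ∀ {φ : ℕ → ℕ} {V : H →L[ℂ] H}, (∀ n, V (u n) = u (φ n)) → φ.Injective →
      ∀ n, V.adjoint (u (φ n)) = u n := by
    intro φ V hV hφ n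
    refine eq_of_forall_inner_hilbertBasis u fun m => ?_
    rw [V.adjoint_inner_right, hV, orthonormal_iff_ite.1 u.orthonormal,
      orthonormal_iff_ite.1 u.orthonormal]
    simp only [hφ.eq_iff]
  have hadj0 : ∀ {φ : ℕ → ℕ} {V : H →L[ℂ] H}, (∀ n, V (u n) = u (φ n)) →
      ∀ m, (∀ n, φ n ≠ m) → V.adjoint (u m) = 0 := by
    intro φ V hV m hm
    refine eq_of_forall_inner_hilbertBasis u fun n => ?_
    rw [V.adjoint_inner_right, hV, u.orthonormal.2 (hm n), inner_zero_right]
  have hi0 : Function.Injective fun n => 2 * n := fun a b h => by simpa using h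
  have hi1 : Function.Injective fun n => 2 * n + 1 := fun a b h => by simpa using h
  obtain ⟨V, hV, -⟩ := exists_clm_apply_hilbertBasis u (hinj hi0) fun n => (u.orthonormal.1 _).le
  obtain ⟨W, hW, -⟩ := exists_clm_apply_hilbertBasis u (hinj hi1) fun n => (u.orthonormal.1 _).le
  refine ⟨V, W, clm_ext_hilbertBasis u fun m => ?_⟩
  rw [hD' m, add_apply]
  simp only [mul_apply_eq_comp]
  obtain ⟨k, rfl | rfl⟩ := Nat.even_or_odd' m
  · have h1 : V.adjoint (u (2 * k)) = u k := hadj hV hi0 k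
    have h2 : W.adjoint (u (2 * k)) = 0 := hadj0 hW _ fun n => by omega
    rw [h1, h2, hD k, map_smul, hV, map_zero, map_zero, add_zero]
    simp
  · have h1 : W.adjoint (u (2 * k + 1)) = u k := hadj hW hi1 k
    have h2 : V.adjoint (u (2 * k + 1)) = 0 := hadj0 hV _ fun n => by omega
    rw [h1, h2, hD k, map_smul, hW, map_zero, map_zero, zero_add,
      show (2 * k + 1) / 2 = k by omega]

theorem isCharSet_charSet (hH : ¬ FiniteDimensional ℂ H) (hI : I ≠ ⊤) :
    IsCharSet (charSet I) := by
  obtain ⟨u⟩ := exists_hilbertBasis_nat hH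
  have hsub : charSet I ⊆ cZeroStar := by
    rintro _ ⟨X, hX, rfl⟩
    exact sNumbers_mem_cZeroStar_of_mem hH hI hX
  have hdiag : ∀ {ξ D}, ξ ∈ charSet I → IsDiag u D ξ → D ∈ I := fun hξ hD => by
    rw [mem_iff_sNumbers_mem_charSet hH hI, hD.sNumbers_eq (hsub hξ)]
    exact hξ
  refine ⟨hsub, ⟨0, I.zero_mem, sNumbers_zero⟩, ?_, ?_, ?_⟩
  · intro ξ η hξ hη
    obtain ⟨D, hD⟩ := exists_isDiag_of_mem u (hsub hξ)
    obtain ⟨E, hE⟩ := exists_isDiag_of_mem u (hsub hη)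
    exact ⟨D + E, I.add_mem (hdiag hξ hD) (hdiag hη hE),
      (hD.add hE).sNumbers_eq (cZeroStar.add (hsub hξ) (hsub hη))⟩
  · intro ξ hξ
    have hd := cZeroStar.dilate (hsub hξ)
    obtain ⟨D, hD⟩ := exists_isDiag_of_mem u (hsub hξ)
    obtain ⟨D', hD'⟩ := exists_isDiag_of_mem u hd
    refine ⟨D', ?_, hD'.sNumbers_eq hd⟩
    obtain ⟨V, W, hVW⟩ := exists_isometries_isDiag_dilate u hD hD'
    have hDI := hdiag hξ hD
    rw [hVW]
    exact I.add_mem (I.mul_mem_right _ _ (I.mul_mem_left _ _ hDI))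
      (I.mul_mem_right _ _ (I.mul_mem_left _ _ hDI))
  · rintro _ ζ C ⟨X, hX, rfl⟩ hζ hC
    obtain ⟨D, hD⟩ := exists_isDiag_of_mem u hζ
    have hs := hD.sNumbers_eq hζ
    exact ⟨D, mem_of_sNumbers_le hH hX (sNumbers_mem_cZeroStar_of_mem hH hI hX) (hs ▸ hζ) C
      (hs ▸ hC), hs⟩

omit [CompleteSpace H] [TopologicalSpace.SeparableSpace H] in
-- The s-number inequalities make the set of X with s(X) ∈ S an ideal already, so taking the span
-- adds nothing.
theorem mem_idealOf_iff {S : Set (ℕ → ℝ)} (hS : IsCharSet S) {X : H →L[ℂ] H} :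
    X ∈ idealOf H S ↔ sNumbers X ∈ S := by
  refine ⟨fun h => ?_, fun h => TwoSidedIdeal.subset_span h⟩
  have hlim : ∀ {X Y : H →L[ℂ] H} (c : ℝ), sNumbers X ∈ S →
      (∀ n, sNumbers Y n ≤ c * sNumbers X n) → sNumbers Y ∈ S := fun {X Y} c hX hY => by
    refine hS.of_le c hX ⟨sNumbers_antitone Y, ?_⟩ hY
    refine squeeze_zero (sNumbers_nonneg Y) hY ?_
    simpa using (hS.subset hX).2.const_mul c
  have hleft : ∀ {A X : H →L[ℂ] H}, sNumbers X ∈ S → sNumbers (A * X) ∈ S := fun {A X} hX =>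
    hlim ‖A‖ hX (sNumbers_mul_le_left A X)
  let J : TwoSidedIdeal (H →L[ℂ] H) := TwoSidedIdeal.mk' {X | sNumbers X ∈ S}
    (by
      change sNumbers 0 ∈ S
      rw [sNumbers_zero]
      exact hS.zero_mem)
    (fun {X Y} hX hY => by
      have hXY := hS.add_mem (hS.dilate_mem hX) (hS.dilate_mem hY)
      refine hS.of_le 1 hXY ⟨sNumbers_antitone _, ?_⟩ fun n => ?_
      · exact squeeze_zero (sNumbers_nonneg _) (sNumbers_add_le X Y) (hS.subset hXY).2
      · simpa using sNumbers_add_le X Y n)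
    (fun {X} hX => by
      rw [← neg_one_mul]
      exact hleft hX)
    (fun hX => hleft hX)
    (fun {X B} hX => hlim ‖B‖ hX (sNumbers_mul_le_right X B))
  have hJ : idealOf H S ≤ J := TwoSidedIdeal.span_le.2 fun X hX => by
    simpa [J] using hX
  simpa [J] using hJ h

theorem charSet_idealOf (hH : ¬ FiniteDimensional ℂ H) {S : Set (ℕ → ℝ)} (hS : IsCharSet S) :
    charSet (idealOf H S) = S := by
  obtain ⟨u⟩ := exists_hilbertBasis_nat hH
  ext ξ
  constructor
  · rintro ⟨X, hX, rfl⟩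
    exact (mem_idealOf_iff hS).1 hX
  · intro hξ
    obtain ⟨D, hD⟩ := exists_isDiag_of_mem u (hS.subset hξ)
    have hs := hD.sNumbers_eq (hS.subset hξ)
    exact ⟨D, (mem_idealOf_iff hS).2 (hs ▸ hξ), hs⟩

theorem eq_idealOf_iff (hH : ¬ FiniteDimensional ℂ H) (hI : I ≠ ⊤) {S : Set (ℕ → ℝ)}
    (hS : IsCharSet S) : I = idealOf H S ↔ charSet I = S := by
  constructor
  · rintro h
    rw [h, charSet_idealOf hH hS]
  · rintro h
    ext X
    rw [mem_iff_sNumbers_mem_charSet hH hI, mem_idealOf_iff hS, h]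

/-- The sequences dominated by the recursion form a characteristic set whose ideal contains every
generator, hence all of I. -/
theorem IsCountablyGenerated.exists_dominating (hH : ¬ FiniteDimensional ℂ H) (hI : I ≠ ⊤)
    (hgen : IsCountablyGenerated I) :
    ∃ θ : ℕ → ℕ → ℝ, (∀ k, θ k ∈ charSet I) ∧ ∀ ξ ∈ charSet I, ∃ k, ∀ n, ξ n ≤ θ k n := by
  obtain ⟨G, hG, hIG⟩ := hgen
  have hS := isCharSet_charSet hH hI
  -- Adjoining 0 ensures a nonempty set, which can be enumerated by ℕ.
  obtain ⟨g, hg⟩ := (hG.insert 0).exists_eq_range (Set.insert_nonempty 0 G)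
  have hgI : ∀ k, g k ∈ I := by
    intro k
    rcases (hg ▸ Set.mem_range_self k : g k ∈ insert 0 G) with h | h
    · rw [h]
      exact I.zero_mem
    · rw [hIG]
      exact TwoSidedIdeal.subset_span h
  have hσ : ∀ k, sNumbers (g k) ∈ charSet I := fun k => ⟨g k, hgI k, rfl⟩
  refine ⟨dominating fun k => sNumbers (g k), dominating_mem hS hσ, ?_⟩
  have hT := isCharSet_dominated hS hσ
  have hle : I ≤ idealOf H _ := hIG.trans_le (TwoSidedIdeal.span_le.2 fun X hX => by
    obtain ⟨k, rfl⟩ : X ∈ Set.range g := hg ▸ Set.mem_insert_of_mem 0 hX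
    exact (mem_idealOf_iff hT).2 ⟨hS.subset (hσ k), k, le_dominating hS hσ k⟩)
  rintro _ ⟨X, hX, rfl⟩
  exact ((mem_idealOf_iff hT).1 (hle hX)).2

end Ideals

end OperatorIdeal

theorem theorem2p11 {H : Type*} [NormedAddCommGroup H] [InnerProductSpace ℂ H] [CompleteSpace H]
    [TopologicalSpace.SeparableSpace H] (hH : ¬ FiniteDimensional ℂ H)
    (I : TwoSidedIdeal (H →L[ℂ] H)) (hI : I ≠ ⊤)
    (hgen : OperatorIdeal.IsCountablyGenerated I) :
    OperatorIdeal.IsAMClosed I ↔ OperatorIdeal.IsAMStable I := by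
  have hS := OperatorIdeal.isCharSet_charSet hH hI
  have hstable : OperatorIdeal.IsAMStable I ↔
      OperatorIdeal.charSet I = OperatorIdeal.meanSet (OperatorIdeal.charSet I) :=
    OperatorIdeal.eq_idealOf_iff hH hI hS.meanSet
  have hmean : OperatorIdeal.charSet (OperatorIdeal.meanIdeal I)
      = OperatorIdeal.meanSet (OperatorIdeal.charSet I) :=
    OperatorIdeal.charSet_idealOf hH hS.meanSet
  have hclosed : OperatorIdeal.IsAMClosed I ↔ OperatorIdeal.charSet I =
      OperatorIdeal.preMeanSet (OperatorIdeal.meanSet (OperatorIdeal.charSet I)) := by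
    rw [← hmean]
    refine OperatorIdeal.eq_idealOf_iff hH hI ?_
    exact (hmean ▸ hS.meanSet :
      OperatorIdeal.IsCharSet (OperatorIdeal.charSet (OperatorIdeal.meanIdeal I))).preMeanSet
  rw [hstable, hclosed]
  obtain ⟨θ, hθ, hdom⟩ := hgen.exists_dominating hH hI
  exact ⟨OperatorIdeal.eq_meanSet_of_eq_preMeanSet hS hθ hdom,
    OperatorIdeal.eq_preMeanSet_of_eq_meanSet hS⟩
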